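/- A score sheet of a round-robin tournament of $n$ teams $T_1,\dots,T_n$ is a table of nonnegative integers $g_{ij}$ ($1\le i\ne j\le n$), where $g_{ij}$ is the number of goals that $T_i$ scored against $T_j$ (the diagonal is blank). It is ordered if the totals $g_i=\sum_{j\ne i}g_{ij}$ satisfy $g_1\ge g_2\ge\cdots\ge g_n$. An ordered score sheet is consistent if each of its principal submatrices (obtained by deleting a set of teams, i.e. the rows and columns with the same indices, and keeping the order of the remaining teams) is again an ordered score sheet. Its number of goals is $\sum_i g_i$. A quasipolynomial of degree $d$ and period $p$ is a function $Q(x)=\sum_{i=0}^d a_i(x)x^i$ on $\mathbb Z$ with periodic coefficient functions $a_i:\mathbb Z\to\mathbb Q$, where $a_d\ne 0$ and $p$ is the smallest positive common period of the $a_i$. Let $n=3$ and let $Q_c(G)$ denote the number of consistent score sheets with $G$ goals; this number is finite for every $G\ge 0$. Then $Q_c$ is (the restriction to $G\ge 0$ of) a quasipolynomial of degree $5$ and period $12$. Its Hilbert series is $$\sum_{G=0}^\infty Q_c(G)t^G=\frac{R(t)}{(1-t)^2(1-t^3)(1-t^6)^2(1-t^{12})},$$ where $$\begin{aligned}R(t)=\;&1+3t^2+t^3+6t^4+2t^5+10t^6+t^7+13t^8+3t^9+11t^{10}\\&+3t^{11}+13t^{12}+t^{13}+10t^{14}+2t^{15}+6t^{16}+t^{17}+3t^{18}+t^{20}\end{aligned}$$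 is palindromic of degree $20$. Explicitly, for all integers $G\ge 0$, $$Q_c(G)=\begin{cases} 1+\tfrac{49}{45}G+\tfrac{1}{2}G^2+\tfrac{299}{2592}G^3+\tfrac{91}{6912}G^4+\tfrac{91}{155520}G^5 & \text{if } G\equiv 0 \pmod{12} \\ \tfrac{34291}{62208}+\tfrac{44263}{51840}G+\tfrac{14521}{31104}G^2+\tfrac{889}{7776}G^3+\tfrac{91}{6912}G^4+\tfrac{91}{155520}G^5 & \text{if } G\equiv 1 \pmod{12} \\ \tfrac{3245}{3888}+\tfrac{1679}{1620}G+\tfrac{947}{1944}G^2+\tfrac{889}{7776}G^3+\tfrac{91}{6912}G^4+\tfrac{91}{155520}G^5 & \text{if } G\equiv 2 \pmod{12} \\ \tfrac{145}{256}+\tfrac{5327}{5760}G+\tfrac{185}{384}G^2+\tfrac{299}{2592}G^3+\tfrac{91}{6912}G^4+\tfrac{91}{155520}G^5 & \text{if } G\equiv 3 \pmod{12} \\ \tfrac{214}{243}+\tfrac{1649}{1620}G+\tfrac{943}{1944}G^2+\tfrac{889}{7776}G^3+\tfrac{91}{6912}G^4+\tfrac{91}{155520}G^5 & \text{if } G\equiv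 4 \pmod{12} \\ \tfrac{35315}{62208}+\tfrac{45223}{51840}G+\tfrac{14585}{31104}G^2+\tfrac{889}{7776}G^3+\tfrac{91}{6912}G^4+\tfrac{91}{155520}G^5 & \text{if } G\equiv 5 \pmod{12} \\ \tfrac{15}{16}+\tfrac{49}{45}G+\tfrac{1}{2}G^2+\tfrac{299}{2592}G^3+\tfrac{91}{6912}G^4+\tfrac{91}{155520}G^5 & \text{if } G\equiv 6 \pmod{12} \\ \tfrac{30403}{62208}+\tfrac{44263}{51840}G+\tfrac{14521}{31104}G^2+\tfrac{889}{7776}G^3+\tfrac{91}{6912}G^4+\tfrac{91}{155520}G^5 & \text{if } G\equiv 7 \pmod{12} \\ \tfrac{218}{243}+\tfrac{1679}{1620}G+\tfrac{947}{1944}G^2+\tfrac{889}{7776}G^3+\tfrac{91}{6912}G^4+\tfrac{91}{155520}G^5 & \text{if } G\equiv 8 \pmod{12} \\ \tfrac{161}{256}+\tfrac{5327}{5760}G+\tfrac{185}{384}G^2+\tfrac{299}{2592}G^3+\tfrac{91}{6912}G^4+\tfrac{91}{155520}G^5 & \text{if } G\equiv 9 \pmod{12} \\ \tfrac{3181}{3888}+\tfrac{1649}{1620}G+\tfrac{943}{1944}G^2+\tfrac{889}{7776}G^3+\tfrac{91}{6912}G^4+\tfrac{91}{155520}G^5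 & \text{if } G\equiv 10 \pmod{12} \\ \tfrac{31427}{62208}+\tfrac{45223}{51840}G+\tfrac{14585}{31104}G^2+\tfrac{889}{7776}G^3+\tfrac{91}{6912}G^4+\tfrac{91}{155520}G^5 & \text{if } G\equiv 11 \pmod{12} \end{cases}$$ -/

import Mathlib

/-- A score sheet of a round-robin tournament of `n` teams `T_0, …, T_{n-1}`: `goals i j` is the
number of goals that team `i` scored against team `j`. The diagonal, which is blank in a score
sheet, is stored as `0`, so that two sheets are equal iff their off-diagonal entries agree. -/
@[ext]
structure ScoreSheet (n : ℕ) where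
  goals : Fin n → Fin n → ℕ
  diag : ∀ i, goals i i = 0

namespace ScoreSheet

/-- The total number of goals scored by team `i`. -/
def teamGoals {n : ℕ} (S : ScoreSheet n) (i : Fin n) : ℕ :=
  ∑ j ∈ Finset.univ.filter (fun j => j ≠ i), S.goals i j

/-- The degree of a score sheet: the total number of goals scored in the tournament. -/
def degree {n : ℕ} (S : ScoreSheet n) : ℕ := ∑ i, S.teamGoals i

/-- A score sheet is ordered if `g_0 ≥ g_1 ≥ ⋯ ≥ g_{n-1}` for the teams' total goals `g_i`. -/
def IsOrdered {n : ℕ} (S : ScoreSheet n) : Prop :=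
  ∀ i j : Fin n, i ≤ j → S.teamGoals j ≤ S.teamGoals i

/-- The principal submatrix on the rows and columns `e 0 < e 1 < ⋯ < e (k-1)`, i.e. the score sheet
that is left, in the original order of teams, after all the other teams have been removed. -/
def principal {n k : ℕ} (S : ScoreSheet n) (e : Fin k ↪o Fin n) : ScoreSheet k where
  goals i j := S.goals (e i) (e j)
  diag i := S.diag (e i)

/-- An ordered score sheet is consistent if all its principal submatrices are ordered. -/
def IsConsistent {n : ℕ} (S : ScoreSheet n) : Prop :=
  S.IsOrdered ∧ ∀ (k : ℕ) (e : Fin k ↪o Fin n), (S.principal e).IsOrdered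

/-- The consistent score sheets of `n` teams with `G` goals in total. -/
def consistentSheets (n G : ℕ) : Set (ScoreSheet n) :=
  {S | S.IsConsistent ∧ S.degree = G}

/-- The number of consistent score sheets of `n` teams with `G` goals in total. -/
noncomputable def numConsistent (n G : ℕ) : ℕ := (consistentSheets n G).ncard

end ScoreSheet

/-- `Q` is a quasipolynomial with rational coefficients, of degree `d` and period `p`:
`Q x = a_d(x) x^d + ⋯ + a_1(x) x + a_0(x)` with periodic coefficient functions `a_i : ℤ → ℚ`,
where `a_d` is not the zero function and `p` is the smallest positive common period of the `a_i`. -/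
def IsQuasipolynomial (Q : ℤ → ℚ) (d p : ℕ) : Prop :=
  ∃ a : Fin (d + 1) → ℤ → ℚ,
    (∀ x : ℤ, Q x = ∑ i : Fin (d + 1), a i x * (x : ℚ) ^ (i : ℕ)) ∧
    a (Fin.last d) ≠ 0 ∧
    IsLeast {q : ℕ | 0 < q ∧ ∀ i, Function.Periodic (a i) (q : ℤ)} p

open Polynomial in
/-- The numerator of the Hilbert series of consistent score sheets of three teams. -/
noncomputable def consistentNumerator : ℤ[X] :=
  1 + 3 * X ^ 2 + X ^ 3 + 6 * X ^ 4 + 2 * X ^ 5 + 10 * X ^ 6 + X ^ 7 + 13 * X ^ 8 + 3 * X ^ 9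
    + 11 * X ^ 10 + 3 * X ^ 11 + 13 * X ^ 12 + X ^ 13 + 10 * X ^ 14 + 2 * X ^ 15 + 6 * X ^ 16
    + X ^ 17 + 3 * X ^ 18 + X ^ 20

/-! Consistency for three teams amounts to the three pairwise inequalities together with $g_1\ge
g_2\ge g_3$. Recording the entries above the diagonal as surpluses over their mirror entries
(`ofParams`) leaves six free parameters and two inequalities, $e\le c+r$ and $f+r\le p+q+e$.
Splitting on $e\le c$ or $e>c$ turns the first into one free natural number and leaves, in both
cases, the same cone $f+r\le p+q+e$ of weight $2f+r+p+q+4e$ (`hasGenFun_isConsistent`).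

That cone is a disjoint union of six half-open cones, each freely generated by five vectors
(`hasGenFun_orderCone`), so its series is a sum of six shifted products of geometric series. Adding
fractions gives the Hilbert series (`hilbertSeries_numConsistent`).

The denominator has degree 29, so the counts obey a linear recurrence of order 29. The claimed
constituents obey it too, and the first 29 values agree (`eq_constituent_of_hilbertSeries`). -/

/-! ### Generating functions of weighted sets -/

open PowerSeries in
/-- The points of `s` of weight `n` are finite in number, and counted by the coefficient of `X ^ n`
in `φ`. -/
def HasGenFun {α : Type*} (s : Set α) (w : α → ℕ) (φ : ℤ⟦X⟧) : Prop :=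
  ∀ n, {a ∈ s | w a = n}.Finite ∧ ({a ∈ s | w a = n}.ncard : ℤ) = coeff n φ

/-- The geometric series `1 + X ^ k + X ^ (2 * k) + ⋯`. -/
noncomputable def geomSeries (k : ℕ) : PowerSeries ℤ :=
  PowerSeries.mk fun n => if k ∣ n then 1 else 0

theorem one_sub_X_pow_mul_geomSeries {k : ℕ} (hk : 0 < k) :
    (1 - PowerSeries.X ^ k) * geomSeries k = 1 := by
  ext n
  rw [sub_mul, one_mul, map_sub, PowerSeries.coeff_X_pow_mul', PowerSeries.coeff_one]
  simp only [geomSeries, PowerSeries.coeff_mk]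
  rcases eq_or_ne n 0 with rfl | hn
  · simp [hk.ne']
  · by_cases h : k ≤ n
    · have : k ∣ n ∨ n ≤ k ↔ k ∣ n := or_iff_left_of_imp fun h' => (h'.antisymm h) ▸ dvd_rfl
      simp [h, hn, Nat.dvd_sub_self_right, this]
    · have : ¬ k ∣ n := fun hd => h (Nat.le_of_dvd (Nat.pos_of_ne_zero hn) hd)
      simp [h, hn, this]

namespace HasGenFun

variable {α β : Type*} {s : Set α} {t : Set β} {φ ψ : PowerSeries ℤ}

theorem nat_mul {k : ℕ} (hk : 0 < k) :
    HasGenFun Set.univ (fun n : ℕ => k * n) (geomSeries k) := by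
  intro n
  simp only [geomSeries, PowerSeries.coeff_mk]
  split_ifs with h
  · obtain ⟨m, rfl⟩ := h
    have : {a : ℕ | a ∈ Set.univ ∧ k * a = k * m} = {m} := by
      ext a; simp [hk.ne']
    rw [this]
    simp
  · have : {a : ℕ | a ∈ Set.univ ∧ k * a = n} = ∅ := by
      ext a
      simp only [Set.mem_univ, true_and, Set.mem_ofPred_eq, Set.mem_empty_iff_false, iff_false]
      exact fun ha => h ⟨a, ha.symm⟩
    rw [this]
    simp

/-- The pairs of total weight `n` are partitioned by their two weights, which run over the
antidiagonal of `n`; this is the Cauchy product. -/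
theorem prod {v : α → ℕ} {w : β → ℕ} (hs : HasGenFun s v φ) (ht : HasGenFun t w ψ) :
    HasGenFun (s ×ˢ t) (fun x => v x.1 + w x.2) (φ * ψ) := by
  classical
  have hsf := fun i => (hs i).1
  have htf := fun i => (ht i).1
  have hsc := fun i => (Set.ncard_eq_toFinset_card _ (hsf i)) ▸ (hs i).2
  have htc := fun i => (Set.ncard_eq_toFinset_card _ (htf i)) ▸ (ht i).2
  intro n
  have key : {x | x ∈ s ×ˢ t ∧ v x.1 + w x.2 = n} =
      (((Finset.HasAntidiagonal.antidiagonal n).biUnion fun ij =>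
        (hsf ij.1).toFinset ×ˢ (htf ij.2).toFinset : Finset (α × β)) : Set (α × β)) := by
    ext x
    simp only [Set.mem_prod, Set.mem_ofPred_eq, Finset.coe_biUnion, Finset.mem_coe,
      Finset.HasAntidiagonal.mem_antidiagonal, Finset.coe_product, Set.Finite.coe_toFinset, Set.mem_iUnion,
      exists_prop]
    constructor
    · rintro ⟨⟨h1, h2⟩, h⟩
      exact ⟨(v x.1, w x.2), h, ⟨h1, rfl⟩, h2, rfl⟩
    · rintro ⟨⟨i, j⟩, h, ⟨h1, rfl⟩, h2, rfl⟩
      exact ⟨⟨h1, h2⟩, h⟩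
  rw [key]
  refine ⟨Finset.finite_toSet _, ?_⟩
  rw [Set.ncard_coe_finset, Finset.card_biUnion, PowerSeries.coeff_mul, Nat.cast_sum]
  · refine Finset.sum_congr rfl fun ij _ => ?_
    rw [Finset.card_product, Nat.cast_mul, hsc, htc]
  · rintro ⟨i, j⟩ - ⟨i', j'⟩ - hne
    refine Finset.disjoint_left.2 ?_
    intro x hx hx'
    simp only [Finset.mem_product, Set.Finite.mem_toFinset, Set.mem_ofPred_eq] at hx hx'
    exact hne (by rw [← hx.1.2, ← hx.2.2, ← hx'.1.2, ← hx'.2.2])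

theorem const_add {w : α → ℕ} (h : HasGenFun s w φ) (c : ℕ) :
    HasGenFun s (fun a => c + w a) (PowerSeries.X ^ c * φ) := by
  intro n
  rw [PowerSeries.coeff_X_pow_mul']
  split_ifs with hc
  · have : {a | a ∈ s ∧ c + w a = n} = {a ∈ s | w a = n - c} := by
      ext a
      refine and_congr_right fun _ => ?_
      omega
    rw [this]
    exact h _
  · have : {a | a ∈ s ∧ c + w a = n} = ∅ := by
      ext a
      simp only [Set.mem_ofPred_eq, Set.mem_empty_iff_false, iff_false]
      omega
    simp [this]

theorem image {w : β → ℕ} {f : α → β} (hf : Set.InjOn f s) (h : HasGenFun s (w ∘ f) φ) :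
    HasGenFun (f '' s) w φ := by
  intro n
  have : {b ∈ f '' s | w b = n} = f '' {a ∈ s | (w ∘ f) a = n} := by
    ext b
    constructor
    · rintro ⟨⟨a, ha, rfl⟩, hb⟩
      exact ⟨a, ⟨ha, hb⟩, rfl⟩
    · rintro ⟨a, ⟨ha, hb⟩, rfl⟩
      exact ⟨⟨a, ha, rfl⟩, hb⟩
  rw [this, Set.InjOn.ncard_image (hf.mono fun a ha => ha.1)]
  exact ⟨(h n).1.image f, (h n).2⟩

theorem union {s' : Set α} {w : α → ℕ} (hd : Disjoint s s') (h : HasGenFun s w φ)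
    (h' : HasGenFun s' w ψ) : HasGenFun (s ∪ s') w (φ + ψ) := by
  intro n
  have : {a ∈ s ∪ s' | w a = n} = {a ∈ s | w a = n} ∪ {a ∈ s' | w a = n} := by
    ext a
    exact or_and_right
  rw [this]
  refine ⟨(h n).1.union (h' n).1, ?_⟩
  rw [Set.ncard_union_eq (hd.mono (fun a ha => ha.1) fun a ha => ha.1) (h n).1 (h' n).1,
    Nat.cast_add, (h n).2, (h' n).2, map_add]

/-- Half-open simplicial cones: five free parameters of weights `k₁, …, k₅`, with an offset `c`. -/
theorem range_of_injective {w : α → ℕ} (f : ℕ × ℕ × ℕ × ℕ × ℕ → α) (c k₁ k₂ k₃ k₄ k₅ : ℕ)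
    (h₁ : 0 < k₁) (h₂ : 0 < k₂) (h₃ : 0 < k₃) (h₄ : 0 < k₄) (h₅ : 0 < k₅)
    (hf : Function.Injective f)
    (hw : ∀ x, w (f x) =
      c + (k₁ * x.1 + (k₂ * x.2.1 + (k₃ * x.2.2.1 + (k₄ * x.2.2.2.1 + k₅ * x.2.2.2.2))))) :
    HasGenFun (Set.range f) w (PowerSeries.X ^ c * (geomSeries k₁ * (geomSeries k₂ *
      (geomSeries k₃ * (geomSeries k₄ * geomSeries k₅))))) := by
  have h := (((nat_mul h₁).prod ((nat_mul h₂).prod ((nat_mul h₃).prod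
    ((nat_mul h₄).prod (nat_mul h₅))))).const_add c)
  rw [← Set.image_univ]
  refine image hf.injOn ?_
  rw [show w ∘ f = _ from funext hw]
  simpa only [Set.univ_prod_univ] using h

end HasGenFun

/-! ### Decomposition of the cone into six half-open simplicial cones -/

/-- The cone of all `(f, r, p, q, e)` with `f + r ≤ p + q + e`. -/
def orderCone : Set (ℕ × ℕ × ℕ × ℕ × ℕ) :=
  {x | x.1 + x.2.1 ≤ x.2.2.1 + x.2.2.2.1 + x.2.2.2.2}

/-- The weight of a point `(f, r, p, q, e)`. -/
def coneWeight (x : ℕ × ℕ × ℕ × ℕ × ℕ) : ℕ :=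
  2 * x.1 + x.2.1 + x.2.2.1 + x.2.2.2.1 + 4 * x.2.2.2.2

/-- The generating function of `orderCone`. -/
noncomputable def coneSeries : PowerSeries ℤ :=
  PowerSeries.X ^ 0 * (geomSeries 3 * (geomSeries 2 * (geomSeries 1 *
    (geomSeries 1 * geomSeries 4)))) +
  (PowerSeries.X ^ 2 * (geomSeries 3 * (geomSeries 2 * (geomSeries 2 *
    (geomSeries 1 * geomSeries 4)))) +
  (PowerSeries.X ^ 5 * (geomSeries 3 * (geomSeries 2 * (geomSeries 2 *
    (geomSeries 5 * geomSeries 4)))) +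
  (PowerSeries.X ^ 3 * (geomSeries 3 * (geomSeries 3 * (geomSeries 2 *
    (geomSeries 1 * geomSeries 4)))) +
  (PowerSeries.X ^ 8 * (geomSeries 3 * (geomSeries 3 * (geomSeries 2 *
    (geomSeries 5 * geomSeries 4)))) +
  PowerSeries.X ^ 6 * (geomSeries 3 * (geomSeries 3 * (geomSeries 6 *
    (geomSeries 5 * geomSeries 4))))))))

/-- Read `f`, `r` as demands met greedily from the supplies `p`, `q`, `e` in this order, `f` before
`r`. The supply at which each demand is completed gives six cases. The generators of a case are the
matches used and the leftovers: `f` with `p`, `q`, `e` weighs 3, 3, 6; `r` with `p`, `q`, `e` weighs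
2, 2, 5; leftovers weigh 1, 1, 4. A demand that overflows into a later supply must use at least one
unit there; these strict inequalities make the pieces disjoint and produce the offsets. -/
theorem hasGenFun_orderCone : HasGenFun orderCone coneWeight coneSeries := by
  have h1 := HasGenFun.range_of_injective (w := coneWeight)
    (fun x => (x.1, x.2.1, x.1 + x.2.1 + x.2.2.1, x.2.2.2.1, x.2.2.2.2)) 0 3 2 1 1 4
    (by norm_num) (by norm_num) (by norm_num) (by norm_num) (by norm_num)
    (fun x y h => by simp only [Prod.ext_iff] at h ⊢; omega)
    (fun x => by simp only [coneWeight]; omega)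
  have h2 := HasGenFun.range_of_injective (w := coneWeight)
    (fun x => (x.1, x.2.1 + 1 + x.2.2.1, x.1 + x.2.1, 1 + x.2.2.1 + x.2.2.2.1, x.2.2.2.2))
    2 3 2 2 1 4
    (by norm_num) (by norm_num) (by norm_num) (by norm_num) (by norm_num)
    (fun x y h => by simp only [Prod.ext_iff] at h ⊢; omega)
    (fun x => by simp only [coneWeight]; omega)
  have h3 := HasGenFun.range_of_injective (w := coneWeight)
    (fun x => (x.1, x.2.1 + x.2.2.1 + 1 + x.2.2.2.1, x.1 + x.2.1, x.2.2.1,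
      x.2.2.2.1 + 1 + x.2.2.2.2)) 5 3 2 2 5 4
    (by norm_num) (by norm_num) (by norm_num) (by norm_num) (by norm_num)
    (fun x y h => by simp only [Prod.ext_iff] at h ⊢; omega)
    (fun x => by simp only [coneWeight]; omega)
  have h4 := HasGenFun.range_of_injective (w := coneWeight)
    (fun x => (x.1 + 1 + x.2.1, x.2.2.1, x.1, 1 + x.2.1 + x.2.2.1 + x.2.2.2.1, x.2.2.2.2))
    3 3 3 2 1 4
    (by norm_num) (by norm_num) (by norm_num) (by norm_num) (by norm_num)
    (fun x y h => by simp only [Prod.ext_iff] at h ⊢; omega)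
    (fun x => by simp only [coneWeight]; omega)
  have h5 := HasGenFun.range_of_injective (w := coneWeight)
    (fun x => (x.1 + 1 + x.2.1, x.2.2.1 + 1 + x.2.2.2.1, x.1, 1 + x.2.1 + x.2.2.1,
      1 + x.2.2.2.1 + x.2.2.2.2)) 8 3 3 2 5 4
    (by norm_num) (by norm_num) (by norm_num) (by norm_num) (by norm_num)
    (fun x y h => by simp only [Prod.ext_iff] at h ⊢; omega)
    (fun x => by simp only [coneWeight]; omega)
  have h6 := HasGenFun.range_of_injective (w := coneWeight)
    (fun x => (x.1 + x.2.1 + 1 + x.2.2.1, x.2.2.2.1, x.1, x.2.1,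
      1 + x.2.2.1 + x.2.2.2.1 + x.2.2.2.2)) 6 3 3 6 5 4
    (by norm_num) (by norm_num) (by norm_num) (by norm_num) (by norm_num)
    (fun x y h => by simp only [Prod.ext_iff] at h ⊢; omega)
    (fun x => by simp only [coneWeight]; omega)
  have h := h1.union ?_ (h2.union ?_ (h3.union ?_ (h4.union ?_ (h5.union ?_ h6))))
  · unfold coneSeries
    convert h using 1
    ext ⟨f, r, p, q, e⟩
    simp only [orderCone, Set.mem_ofPred_eq, Set.mem_union, Set.mem_range, Prod.exists,
      Prod.mk.injEq]
    constructor
    · intro hx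
      -- Run the greedy matching: the comparisons locate where `f` and then `r` is exhausted, and
      -- the witnesses are the matched and leftover amounts, less 1 where a unit is forced.
      rcases le_or_gt f p with hf | hf
      · rcases le_or_gt r (p - f) with hr | hr
        · exact Or.inl ⟨f, r, p - f - r, q, e, by omega⟩
        rcases le_or_gt r (p - f + q) with hr' | hr'
        · exact Or.inr (Or.inl ⟨f, p - f, r - (p - f) - 1, q - (r - (p - f)), e, by omega⟩)
        · exact Or.inr (Or.inr (Or.inl ⟨f, p - f, q, r - (p - f + q) - 1,
            e - (r - (p - f + q)), by omega⟩))
      rcases le_or_gt f (p + q) with hf' | hf'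
      · rcases le_or_gt r (p + q - f) with hr | hr
        · exact Or.inr (Or.inr (Or.inr (Or.inl ⟨p, f - p - 1, r, q - (f - p) - r, e,
            by omega⟩)))
        · exact Or.inr (Or.inr (Or.inr (Or.inr (Or.inl ⟨p, f - p - 1, q - (f - p),
            r - (p + q - f) - 1, e - (r - (p + q - f)), by omega⟩))))
      · exact Or.inr (Or.inr (Or.inr (Or.inr (Or.inr ⟨p, q, f - p - q - 1, r,
          e - (f - p - q) - r, by omega⟩))))
    · rintro (⟨_, _, _, _, _, _⟩ | ⟨_, _, _, _, _, _⟩ | ⟨_, _, _, _, _, _⟩ | ⟨_, _, _, _, _, _⟩ |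
        ⟨_, _, _, _, _, _⟩ | ⟨_, _, _, _, _, _⟩) <;> omega
  all_goals
    rw [Set.disjoint_left]
    rintro _ ⟨x, rfl⟩
    simp only [Set.mem_union, Set.mem_range, Prod.mk.injEq, not_or, not_exists]
  · exact ⟨fun y => by omega, fun y => by omega, fun y => by omega, fun y => by omega,
      fun y => by omega⟩
  · exact ⟨fun y => by omega, fun y => by omega, fun y => by omega, fun y => by omega⟩
  · exact ⟨fun y => by omega, fun y => by omega, fun y => by omega⟩
  · exact ⟨fun y => by omega, fun y => by omega⟩
  · exact fun y => by omega

/-! ### Parametrization of the consistent sheets -/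

namespace ScoreSheet

/-- The sheet of three teams with `c`, `e`, `f` goals below the diagonal, and `c + p`, `e + q`,
`f + r` above it. -/
def ofParams (c e f r p q : ℕ) : ScoreSheet 3 where
  goals := ![![0, c + p, e + q], ![c, 0, f + r], ![e, f, 0]]
  diag i := by fin_cases i <;> rfl

theorem ofParams_inj {c e f r p q c' e' f' r' p' q' : ℕ} :
    ofParams c e f r p q = ofParams c' e' f' r' p' q' ↔
      c = c' ∧ e = e' ∧ f = f' ∧ r = r' ∧ p = p' ∧ q = q' := by
  refine ⟨fun h => ?_, fun ⟨h1, h2, h3, h4, h5, h6⟩ => by subst_vars; rfl⟩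
  have h' := fun i j => congrFun (congrFun (congrArg goals h) i) j
  have h1 := h' 0 1
  have h2 := h' 0 2
  have h3 := h' 1 0
  have h4 := h' 1 2
  have h5 := h' 2 0
  have h6 := h' 2 1
  simp [ofParams] at h1 h2 h3 h4 h5 h6
  omega

theorem teamGoals_zero (S : ScoreSheet 3) : S.teamGoals 0 = S.goals 0 1 + S.goals 0 2 := by
  simp [teamGoals, Finset.sum_filter, Fin.sum_univ_three]

theorem teamGoals_one (S : ScoreSheet 3) : S.teamGoals 1 = S.goals 1 0 + S.goals 1 2 := by
  simp [teamGoals, Finset.sum_filter, Fin.sum_univ_three]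

theorem teamGoals_two (S : ScoreSheet 3) : S.teamGoals 2 = S.goals 2 0 + S.goals 2 1 := by
  simp [teamGoals, Finset.sum_filter, Fin.sum_univ_three]

theorem degree_ofParams (c e f r p q : ℕ) :
    (ofParams c e f r p q).degree = 2 * c + 2 * e + 2 * f + r + p + q := by
  simp [degree, Fin.sum_univ_three, teamGoals_zero, teamGoals_one, teamGoals_two, ofParams]
  ring

theorem isOrdered_three (S : ScoreSheet 3) : S.IsOrdered ↔
    S.goals 1 0 + S.goals 1 2 ≤ S.goals 0 1 + S.goals 0 2 ∧
    S.goals 2 0 + S.goals 2 1 ≤ S.goals 1 0 + S.goals 1 2 := by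
  simp only [← teamGoals_zero, ← teamGoals_one, ← teamGoals_two]
  refine ⟨fun h => ⟨h 0 1 (by decide), h 1 2 (by decide)⟩, fun ⟨h1, h2⟩ i j hij => ?_⟩
  fin_cases i <;> fin_cases j <;> first | exact absurd hij (by decide) | (simp <;> omega)

theorem isOrdered_two (S : ScoreSheet 2) : S.IsOrdered ↔ S.goals 1 0 ≤ S.goals 0 1 := by
  have h0 : S.teamGoals 0 = S.goals 0 1 := by
    simp [teamGoals, Finset.sum_filter]
  have h1 : S.teamGoals 1 = S.goals 1 0 := by
    simp [teamGoals, Finset.sum_filter]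
  rw [← h0, ← h1]
  refine ⟨fun h => h 0 1 (by decide), fun h i j hij => ?_⟩
  fin_cases i <;> fin_cases j <;> first | exact absurd hij (by decide) | exact le_rfl | exact h

theorem isConsistent_three (S : ScoreSheet 3) : S.IsConsistent ↔ S.IsOrdered ∧
    S.goals 1 0 ≤ S.goals 0 1 ∧ S.goals 2 0 ≤ S.goals 0 2 ∧ S.goals 2 1 ≤ S.goals 1 2 := by
  constructor
  · rintro ⟨h, hp⟩
    have key : ∀ i j : Fin 3, i < j → S.goals j i ≤ S.goals i j := fun i j hij => by
      have := hp 2 (OrderEmbedding.ofStrictMono ![i, j]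
        (by intro a b hab; fin_cases a <;> fin_cases b <;> simp_all))
      rw [isOrdered_two] at this
      exact this
    exact ⟨h, key 0 1 (by decide), key 0 2 (by decide), key 1 2 (by decide)⟩
  · rintro ⟨h, h1, h2, h3⟩
    refine ⟨h, fun k e => ?_⟩
    have hk : k ≤ 3 := by simpa using Fintype.card_le_of_injective e e.injective
    interval_cases k
    · exact fun i => i.elim0
    · intro i j _
      rw [Subsingleton.elim i j]
    · rw [isOrdered_two]
      have hlt : e 0 < e 1 := e.strictMono (by decide)
      simp only [principal]
      generalize e 0 = i at *
      generalize e 1 = j at *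
      fin_cases i <;> fin_cases j <;> first | exact absurd hlt (by decide) | assumption
    · have h01 : e 0 < e 1 := e.strictMono (by decide)
      have h12 : e 1 < e 2 := e.strictMono (by decide)
      -- A strictly increasing self-map of `Fin 3` is the identity.
      have e0 : e 0 = 0 := by omega
      have e1 : e 1 = 1 := by omega
      have e2 : e 2 = 2 := by omega
      rw [isOrdered_three] at h ⊢
      simpa only [principal, e0, e1, e2] using h

theorem isConsistent_ofParams (c e f r p q : ℕ) :
    (ofParams c e f r p q).IsConsistent ↔ e ≤ c + r ∧ f + r ≤ p + q + e := by
  rw [isConsistent_three, isOrdered_three]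
  simp [ofParams]
  omega

theorem exists_eq_ofParams {S : ScoreSheet 3} (hS : S.IsConsistent) :
    ∃ c e f r p q, S = ofParams c e f r p q := by
  obtain ⟨-, h1, h2, h3⟩ := (isConsistent_three S).1 hS
  refine ⟨S.goals 1 0, S.goals 2 0, S.goals 2 1, S.goals 1 2 - S.goals 2 1,
    S.goals 0 1 - S.goals 1 0, S.goals 0 2 - S.goals 2 0, ?_⟩
  ext i j
  fin_cases i <;> fin_cases j <;> simp [ofParams, S.diag, h1, h2, h3]

/-- If $e\le c$, then $e\le c+r$ is automatic; the free number $c-e$ has weight 2, and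
$2c+2e=4e+2(c-e)$ explains the weight 4 in `coneWeight`. If $e>c$, set $x=e-c-1$ and $r=x+1+r'$: the
remaining inequality becomes $f+r'\le p+q+c$, the same cone with `c` in the place of `e`, and `x`
has weight $2+1=3$ with offset 3. -/
theorem hasGenFun_isConsistent :
    HasGenFun {S : ScoreSheet 3 | S.IsConsistent} degree
      (geomSeries 2 * coneSeries + PowerSeries.X ^ 3 * (geomSeries 3 * coneSeries)) := by
  have hA : HasGenFun ((fun x : ℕ × ℕ × ℕ × ℕ × ℕ × ℕ => ofParams (x.2.2.2.2.2 + x.1) x.2.2.2.2.2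
      x.2.1 x.2.2.1 x.2.2.2.1 x.2.2.2.2.1) '' (Set.univ ×ˢ orderCone)) degree
      (geomSeries 2 * coneSeries) := by
    refine HasGenFun.image (fun x _ y _ h => ?_) ?_
    · simp only [ofParams_inj] at h
      simp only [Prod.ext_iff]
      omega
    · convert (HasGenFun.nat_mul two_pos).prod hasGenFun_orderCone using 1
      ext x
      simp only [Function.comp_apply, degree_ofParams, coneWeight]
      ring
  have hB : HasGenFun ((fun x : ℕ × ℕ × ℕ × ℕ × ℕ × ℕ => ofParams x.2.2.2.2.2
      (x.2.2.2.2.2 + 1 + x.1) x.2.1 (x.1 + 1 + x.2.2.1) x.2.2.2.1 x.2.2.2.2.1) ''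
      (Set.univ ×ˢ orderCone)) degree (PowerSeries.X ^ 3 * (geomSeries 3 * coneSeries)) := by
    refine HasGenFun.image (fun x _ y _ h => ?_) ?_
    · simp only [ofParams_inj] at h
      simp only [Prod.ext_iff]
      omega
    · convert ((HasGenFun.nat_mul three_pos).prod hasGenFun_orderCone).const_add 3 using 1
      ext x
      simp only [Function.comp_apply, degree_ofParams, coneWeight]
      ring
  convert hA.union ?_ hB using 1
  · ext S
    simp only [Set.mem_ofPred_eq, Set.mem_union, Set.mem_image, Set.mem_prod, Set.mem_univ,
      true_and, orderCone, Prod.exists]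
    constructor
    · intro hS
      obtain ⟨c, e, f, r, p, q, rfl⟩ := exists_eq_ofParams hS
      rw [isConsistent_ofParams] at hS
      rcases le_or_gt e c with h | h
      · exact Or.inl ⟨c - e, f, r, p, q, e, hS.2, by rw [ofParams_inj]; omega⟩
      · exact Or.inr ⟨e - c - 1, f, r - (e - c), p, q, c, by omega, by rw [ofParams_inj]; omega⟩
    · rintro (⟨_, _, _, _, _, _, h, rfl⟩ | ⟨_, _, _, _, _, _, h, rfl⟩) <;>
      · rw [isConsistent_ofParams]
        omega
  · rw [Set.disjoint_left]
    rintro _ ⟨x, -, rfl⟩ ⟨y, -, h⟩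
    simp only [ofParams_inj] at h
    omega

end ScoreSheet

/-! ### The Hilbert series as a rational function -/

/-- Each `gₖ` is the inverse of $1-x^k$, so this is an identity of rational functions. The factor
$1-x^5$ occurs in three of the six pieces but cancels in their sum. -/
theorem geomSeries_sum_identity {K : Type*} [Field K] (x g₁ g₂ g₃ g₄ g₅ g₆ : K)
    (h₁ : (1 - x ^ 1) * g₁ = 1) (h₂ : (1 - x ^ 2) * g₂ = 1) (h₃ : (1 - x ^ 3) * g₃ = 1)
    (h₄ : (1 - x ^ 4) * g₄ = 1) (h₅ : (1 - x ^ 5) * g₅ = 1) (h₆ : (1 - x ^ 6) * g₆ = 1)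
    (F : K) (hF : F = x ^ 0 * (g₃ * (g₂ * (g₁ * (g₁ * g₄)))) +
      (x ^ 2 * (g₃ * (g₂ * (g₂ * (g₁ * g₄)))) + (x ^ 5 * (g₃ * (g₂ * (g₂ * (g₅ * g₄)))) +
      (x ^ 3 * (g₃ * (g₃ * (g₂ * (g₁ * g₄)))) + (x ^ 8 * (g₃ * (g₃ * (g₂ * (g₅ * g₄)))) +
      x ^ 6 * (g₃ * (g₃ * (g₆ * (g₅ * g₄))))))))) :
    (g₂ * F + x ^ 3 * (g₃ * F)) *
        ((1 - x) ^ 2 * (1 - x ^ 3) * (1 - x ^ 6) ^ 2 * (1 - x ^ 12)) =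
      1 + 3 * x ^ 2 + x ^ 3 + 6 * x ^ 4 + 2 * x ^ 5 + 10 * x ^ 6 + x ^ 7 + 13 * x ^ 8 + 3 * x ^ 9
        + 11 * x ^ 10 + 3 * x ^ 11 + 13 * x ^ 12 + x ^ 13 + 10 * x ^ 14 + 2 * x ^ 15 + 6 * x ^ 16
        + x ^ 17 + 3 * x ^ 18 + x ^ 20 := by
  have e₁ := left_ne_zero_of_mul_eq_one h₁
  have e₂ := left_ne_zero_of_mul_eq_one h₂
  have e₃ := left_ne_zero_of_mul_eq_one h₃
  have e₄ := left_ne_zero_of_mul_eq_one h₄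
  have e₅ := left_ne_zero_of_mul_eq_one h₅
  have e₆ := left_ne_zero_of_mul_eq_one h₆
  rw [eq_inv_of_mul_eq_one_right h₁, eq_inv_of_mul_eq_one_right h₂, eq_inv_of_mul_eq_one_right h₃,
    eq_inv_of_mul_eq_one_right h₄, eq_inv_of_mul_eq_one_right h₅,
    eq_inv_of_mul_eq_one_right h₆] at *
  rw [pow_one] at *
  subst hF
  field_simp
  ring

theorem consistentNumerator_eq : (consistentNumerator : PowerSeries ℤ) =
    1 + 3 * PowerSeries.X ^ 2 + PowerSeries.X ^ 3 + 6 * PowerSeries.X ^ 4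
      + 2 * PowerSeries.X ^ 5 + 10 * PowerSeries.X ^ 6 + PowerSeries.X ^ 7
      + 13 * PowerSeries.X ^ 8 + 3 * PowerSeries.X ^ 9 + 11 * PowerSeries.X ^ 10
      + 3 * PowerSeries.X ^ 11 + 13 * PowerSeries.X ^ 12 + PowerSeries.X ^ 13
      + 10 * PowerSeries.X ^ 14 + 2 * PowerSeries.X ^ 15 + 6 * PowerSeries.X ^ 16
      + PowerSeries.X ^ 17 + 3 * PowerSeries.X ^ 18 + PowerSeries.X ^ 20 := by
  change Polynomial.coeToPowerSeries.ringHom consistentNumerator = _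
  simp only [consistentNumerator, map_add, map_mul, map_pow, map_one, map_ofNat,
    Polynomial.coeToPowerSeries.ringHom_apply, Polynomial.coe_X]

theorem hilbertSeries_numConsistent :
    PowerSeries.mk (fun G : ℕ => (ScoreSheet.numConsistent 3 G : ℤ)) *
        ((1 - PowerSeries.X) ^ 2 * (1 - PowerSeries.X ^ 3) * (1 - PowerSeries.X ^ 6) ^ 2 *
          (1 - PowerSeries.X ^ 12)) =
      (consistentNumerator : PowerSeries ℤ) := by
  have hN : PowerSeries.mk (fun G : ℕ => (ScoreSheet.numConsistent 3 G : ℤ)) =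
      geomSeries 2 * coneSeries + PowerSeries.X ^ 3 * (geomSeries 3 * coneSeries) := by
    ext n
    rw [PowerSeries.coeff_mk]
    exact (ScoreSheet.hasGenFun_isConsistent n).2
  rw [hN, consistentNumerator_eq]
  -- Power series over `ℤ` form a domain, so the identity may be checked in the fraction field.
  let ι := algebraMap (PowerSeries ℤ) (FractionRing (PowerSeries ℤ))
  apply IsFractionRing.injective (PowerSeries ℤ) (FractionRing (PowerSeries ℤ))
  have hg : ∀ k, 0 < k → (1 - ι PowerSeries.X ^ k) * ι (geomSeries k) = 1 := fun k hk => by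
    simpa using congrArg ι (one_sub_X_pow_mul_geomSeries hk)
  have h := geomSeries_sum_identity (ι PowerSeries.X) _ _ _ _ _ _ (hg 1 (by norm_num))
    (hg 2 (by norm_num)) (hg 3 (by norm_num)) (hg 4 (by norm_num)) (hg 5 (by norm_num))
    (hg 6 (by norm_num)) (ι coneSeries) (by simp only [coneSeries, map_add, map_mul, map_pow])
  simpa only [map_add, map_mul, map_pow, map_sub, map_one, map_ofNat] using h

/-! ### Linear recurrence and initial values -/

open PowerSeries in
theorem hilbertDenominator_eq : (1 - X) ^ 2 * (1 - X ^ 3) * (1 - X ^ 6) ^ 2 * (1 - X ^ 12) =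
    (C 1 * X ^ 0 - C 2 * X ^ 1 + C 1 * X ^ 2 - C 1 * X ^ 3 + C 2 * X ^ 4 - C 1 * X ^ 5
      - C 2 * X ^ 6 + C 4 * X ^ 7 - C 2 * X ^ 8 + C 2 * X ^ 9 - C 4 * X ^ 10 + C 2 * X ^ 11
      + C 2 * X ^ 18 - C 4 * X ^ 19 + C 2 * X ^ 20 - C 2 * X ^ 21 + C 4 * X ^ 22 - C 2 * X ^ 23
      - C 1 * X ^ 24 + C 2 * X ^ 25 - C 1 * X ^ 26 + C 1 * X ^ 27 - C 2 * X ^ 28 + C 1 * X ^ 29 : ℤ⟦X⟧) := by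
  simp only [map_one, map_ofNat]
  ring

theorem coeff_mk_mul_C_mul_X_pow (N : ℕ → ℤ) (c : ℤ) (k n : ℕ) :
    PowerSeries.coeff n (PowerSeries.mk N * (PowerSeries.C c * PowerSeries.X ^ k)) =
      c * if k ≤ n then N (n - k) else 0 := by
  rw [mul_left_comm, PowerSeries.coeff_C_mul, PowerSeries.coeff_mul_X_pow', PowerSeries.coeff_mk]

theorem coeff_C_mul_X_pow' (c : ℤ) (k n : ℕ) :
    PowerSeries.coeff n (PowerSeries.C c * PowerSeries.X ^ k) = if n = k then c else 0 := by
  rw [PowerSeries.coeff_C_mul, PowerSeries.coeff_X_pow, mul_ite, mul_one, mul_zero]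

open PowerSeries in
theorem consistentNumerator_eq_C : (consistentNumerator : ℤ⟦X⟧) =
    C 1 * X ^ 0 + C 3 * X ^ 2 + C 1 * X ^ 3 + C 6 * X ^ 4 + C 2 * X ^ 5 + C 10 * X ^ 6
      + C 1 * X ^ 7 + C 13 * X ^ 8 + C 3 * X ^ 9 + C 11 * X ^ 10 + C 3 * X ^ 11 + C 13 * X ^ 12
      + C 1 * X ^ 13 + C 10 * X ^ 14 + C 2 * X ^ 15 + C 6 * X ^ 16 + C 1 * X ^ 17 + C 3 * X ^ 18
      + C 1 * X ^ 20 := by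
  rw [consistentNumerator_eq]
  simp only [map_one, map_ofNat]
  ring

/-- A function whose generating function is the Hilbert series satisfies a linear recurrence. -/
theorem recurrence_of_hilbertSeries (N : ℕ → ℤ) (h : PowerSeries.mk N *
      ((1 - PowerSeries.X) ^ 2 * (1 - PowerSeries.X ^ 3) * (1 - PowerSeries.X ^ 6) ^ 2 *
        (1 - PowerSeries.X ^ 12)) = (consistentNumerator : PowerSeries ℤ)) (n : ℕ) :
    N (n + 29) = 2 * N (n + 28) - N (n + 27) + N (n + 26) - 2 * N (n + 25) + N (n + 24)
      + 2 * N (n + 23) - 4 * N (n + 22) + 2 * N (n + 21) - 2 * N (n + 20) + 4 * N (n + 19)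
      - 2 * N (n + 18) - 2 * N (n + 11) + 4 * N (n + 10) - 2 * N (n + 9) + 2 * N (n + 8)
      - 4 * N (n + 7) + 2 * N (n + 6) + N (n + 5) - 2 * N (n + 4) + N (n + 3)
      - N (n + 2) + 2 * N (n + 1) - N n := by
  have hn := congrArg (PowerSeries.coeff (n + 29)) h
  rw [hilbertDenominator_eq, consistentNumerator_eq_C] at hn
  simp only [mul_add, mul_sub, map_add, map_sub, coeff_mk_mul_C_mul_X_pow, coeff_C_mul_X_pow'] at hn
  -- The numerator contributes nothing, since its degree 20 is less than `n + 29`.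
  simp at hn
  linarith

theorem initial_values_of_hilbertSeries (N : ℕ → ℤ) (h : PowerSeries.mk N *
      ((1 - PowerSeries.X) ^ 2 * (1 - PowerSeries.X ^ 3) * (1 - PowerSeries.X ^ 6) ^ 2 *
        (1 - PowerSeries.X ^ 12)) = (consistentNumerator : PowerSeries ℤ)) (n : ℕ) (hn : n < 29) :
    N n = ![1, 2, 6, 12, 24, 41, 72, 110, 172, 253, 364, 506, 704, 935, 1245, 1623, 2086, 2643,
      3343, 4134, 5110, 6251, 7575, 9110, 10937, 12957, 15335, 18040, 21082] (⟨n, hn⟩ : Fin 29) := by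
  rw [hilbertDenominator_eq, consistentNumerator_eq_C] at h
  have hc := fun n => congrArg (PowerSeries.coeff n) h
  simp only [mul_add, mul_sub, map_add, map_sub,
    coeff_mk_mul_C_mul_X_pow, coeff_C_mul_X_pow'] at hc
  -- The denominator has constant term 1, so the coefficient equations are triangular and determine
  -- the values one by one.
  induction n using Nat.strong_induction_on with
  | _ n ih =>
    have h' := hc n
    interval_cases n
    all_goals
      simp [ih] at h'
      simp
      linarith

/-! ### The twelve constituents -/

/-- The coefficients of the constituent of `Q_c` on the residue class of `r` modulo `12`. -/
def constituentCoeff : ℕ → Fin 6 → ℚ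
  | 0 => ![1, 49 / 45, 1 / 2, 299 / 2592, 91 / 6912, 91 / 155520]
  | 1 => ![34291 / 62208, 44263 / 51840, 14521 / 31104, 889 / 7776, 91 / 6912, 91 / 155520]
  | 2 => ![3245 / 3888, 1679 / 1620, 947 / 1944, 889 / 7776, 91 / 6912, 91 / 155520]
  | 3 => ![145 / 256, 5327 / 5760, 185 / 384, 299 / 2592, 91 / 6912, 91 / 155520]
  | 4 => ![214 / 243, 1649 / 1620, 943 / 1944, 889 / 7776, 91 / 6912, 91 / 155520]
  | 5 => ![35315 / 62208, 45223 / 51840, 14585 / 31104, 889 / 7776, 91 / 6912, 91 / 155520]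
  | 6 => ![15 / 16, 49 / 45, 1 / 2, 299 / 2592, 91 / 6912, 91 / 155520]
  | 7 => ![30403 / 62208, 44263 / 51840, 14521 / 31104, 889 / 7776, 91 / 6912, 91 / 155520]
  | 8 => ![218 / 243, 1679 / 1620, 947 / 1944, 889 / 7776, 91 / 6912, 91 / 155520]
  | 9 => ![161 / 256, 5327 / 5760, 185 / 384, 299 / 2592, 91 / 6912, 91 / 155520]
  | 10 => ![3181 / 3888, 1649 / 1620, 943 / 1944, 889 / 7776, 91 / 6912, 91 / 155520]
  | _ => ![31427 / 62208, 45223 / 51840, 14585 / 31104, 889 / 7776, 91 / 6912, 91 / 155520]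

/-- The constituent of `Q_c` on the residue class of `r` modulo `12`. -/
def constituent (r : ℕ) (x : ℚ) : ℚ := ∑ i : Fin 6, constituentCoeff r i * x ^ (i : ℕ)


theorem constituent_apply (x : ℚ) :
    constituent 0 x = 1 + 49 / 45 * x + 1 / 2 * x ^ 2 + 299 / 2592 * x ^ 3
      + 91 / 6912 * x ^ 4 + 91 / 155520 * x ^ 5 ∧
    constituent 1 x = 34291 / 62208 + 44263 / 51840 * x + 14521 / 31104 * x ^ 2 + 889 / 7776 * x ^ 3
      + 91 / 6912 * x ^ 4 + 91 / 155520 * x ^ 5 ∧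
    constituent 2 x = 3245 / 3888 + 1679 / 1620 * x + 947 / 1944 * x ^ 2 + 889 / 7776 * x ^ 3
      + 91 / 6912 * x ^ 4 + 91 / 155520 * x ^ 5 ∧
    constituent 3 x = 145 / 256 + 5327 / 5760 * x + 185 / 384 * x ^ 2 + 299 / 2592 * x ^ 3
      + 91 / 6912 * x ^ 4 + 91 / 155520 * x ^ 5 ∧
    constituent 4 x = 214 / 243 + 1649 / 1620 * x + 943 / 1944 * x ^ 2 + 889 / 7776 * x ^ 3
      + 91 / 6912 * x ^ 4 + 91 / 155520 * x ^ 5 ∧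
    constituent 5 x = 35315 / 62208 + 45223 / 51840 * x + 14585 / 31104 * x ^ 2 + 889 / 7776 * x ^ 3
      + 91 / 6912 * x ^ 4 + 91 / 155520 * x ^ 5 ∧
    constituent 6 x = 15 / 16 + 49 / 45 * x + 1 / 2 * x ^ 2 + 299 / 2592 * x ^ 3
      + 91 / 6912 * x ^ 4 + 91 / 155520 * x ^ 5 ∧
    constituent 7 x = 30403 / 62208 + 44263 / 51840 * x + 14521 / 31104 * x ^ 2 + 889 / 7776 * x ^ 3
      + 91 / 6912 * x ^ 4 + 91 / 155520 * x ^ 5 ∧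
    constituent 8 x = 218 / 243 + 1679 / 1620 * x + 947 / 1944 * x ^ 2 + 889 / 7776 * x ^ 3
      + 91 / 6912 * x ^ 4 + 91 / 155520 * x ^ 5 ∧
    constituent 9 x = 161 / 256 + 5327 / 5760 * x + 185 / 384 * x ^ 2 + 299 / 2592 * x ^ 3
      + 91 / 6912 * x ^ 4 + 91 / 155520 * x ^ 5 ∧
    constituent 10 x = 3181 / 3888 + 1649 / 1620 * x + 943 / 1944 * x ^ 2 + 889 / 7776 * x ^ 3
      + 91 / 6912 * x ^ 4 + 91 / 155520 * x ^ 5 ∧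
    constituent 11 x = 31427 / 62208 + 45223 / 51840 * x + 14585 / 31104 * x ^ 2 + 889 / 7776 * x ^ 3
      + 91 / 6912 * x ^ 4 + 91 / 155520 * x ^ 5 := by
  simp [constituent, constituentCoeff, Fin.sum_univ_six]

/-- Separating the residue `r` from the argument `x` reduces the recurrence to twelve polynomial
identities in a free variable. -/
theorem constituent_recurrence (r : ℕ) (hr : r < 12) (x : ℚ) :
    constituent ((r + 29) % 12) (x + 29) =
      2 * constituent ((r + 28) % 12) (x + 28) - constituent ((r + 27) % 12) (x + 27)
      + constituent ((r + 26) % 12) (x + 26) - 2 * constituent ((r + 25) % 12) (x + 25)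
      + constituent ((r + 24) % 12) (x + 24) + 2 * constituent ((r + 23) % 12) (x + 23)
      - 4 * constituent ((r + 22) % 12) (x + 22) + 2 * constituent ((r + 21) % 12) (x + 21)
      - 2 * constituent ((r + 20) % 12) (x + 20) + 4 * constituent ((r + 19) % 12) (x + 19)
      - 2 * constituent ((r + 18) % 12) (x + 18) - 2 * constituent ((r + 11) % 12) (x + 11)
      + 4 * constituent ((r + 10) % 12) (x + 10) - 2 * constituent ((r + 9) % 12) (x + 9)
      + 2 * constituent ((r + 8) % 12) (x + 8) - 4 * constituent ((r + 7) % 12) (x + 7)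
      + 2 * constituent ((r + 6) % 12) (x + 6) + constituent ((r + 5) % 12) (x + 5)
      - 2 * constituent ((r + 4) % 12) (x + 4) + constituent ((r + 3) % 12) (x + 3)
      - constituent ((r + 2) % 12) (x + 2) + 2 * constituent ((r + 1) % 12) (x + 1)
      - constituent (r % 12) x := by
  have h := constituent_apply
  simp only [forall_and] at h
  obtain ⟨h0, h1, h2, h3, h4, h5, h6, h7, h8, h9, h10, h11⟩ := h
  interval_cases r
  all_goals
    simp only [Nat.reduceAdd, Nat.reduceMod, h0, h1, h2, h3, h4, h5, h6, h7, h8, h9, h10, h11]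
    ring

theorem eq_constituent_of_hilbertSeries (N : ℕ → ℤ) (h : PowerSeries.mk N *
      ((1 - PowerSeries.X) ^ 2 * (1 - PowerSeries.X ^ 3) * (1 - PowerSeries.X ^ 6) ^ 2 *
        (1 - PowerSeries.X ^ 12)) = (consistentNumerator : PowerSeries ℤ)) (G : ℕ) :
    (N G : ℚ) = constituent (G % 12) G := by
  induction G using Nat.strong_induction_on with
  | _ G ih =>
    rcases lt_or_ge G 29 with hG | hG
    · rw [initial_values_of_hilbertSeries N h G hG]
      clear ih
      interval_cases G <;> norm_num [constituent_apply]
    · obtain ⟨n, rfl⟩ := Nat.exists_eq_add_of_le' hG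
      have hr : (N (n + 29) : ℚ) = _ :=
        congrArg (Int.cast : ℤ → ℚ) (recurrence_of_hilbertSeries N h n)
      have ih' : ∀ i < 29, (N (n + i) : ℚ) = constituent ((n % 12 + i) % 12) (n + i) :=
        fun i hi => by
          rw [Nat.mod_add_mod]
          exact_mod_cast ih (n + i) (by omega)
      have h0 : (N n : ℚ) = constituent (n % 12 % 12) n := by
        rw [Nat.mod_mod]
        exact ih n (by omega)
      have hc := constituent_recurrence (n % 12) (Nat.mod_lt _ (by norm_num)) n
      push_cast at hr
      simp (discharger := norm_num) only [ih', h0] at hr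
      rw [Nat.mod_add_mod] at hc
      push_cast at hr hc ih' ⊢
      rw [hr, hc]

/-! ### Palindromic numerator, minimal period and conclusion -/

theorem coeff_consistentNumerator (n : ℕ) : consistentNumerator.coeff n =
    ([1, 0, 3, 1, 6, 2, 10, 1, 13, 3, 11, 3, 13, 1, 10, 2, 6, 1, 3, 0, 1] : List ℤ).getD n 0 := by
  rw [← Polynomial.coeff_coe, consistentNumerator_eq_C]
  simp only [map_add, coeff_C_mul_X_pow']
  rcases lt_or_ge n 21 with h | h
  · interval_cases n <;> rfl
  · rw [List.getD_eq_default _ _ (by simpa using h)]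
    have hne : ∀ k < 21, n ≠ k := fun k hk => by omega
    simp (discharger := norm_num) only [hne, if_false, add_zero]

theorem natDegree_consistentNumerator : consistentNumerator.natDegree = 20 := by
  refine Polynomial.natDegree_eq_of_le_of_coeff_ne_zero ?_ ?_
  · refine Polynomial.natDegree_le_iff_coeff_eq_zero.2 fun n hn => ?_
    rw [coeff_consistentNumerator, List.getD_eq_default _ _ (by simp; omega)]
  · rw [coeff_consistentNumerator]
    norm_num

theorem reverse_consistentNumerator : consistentNumerator.reverse = consistentNumerator := by
  ext n
  rw [Polynomial.coeff_reverse, natDegree_consistentNumerator]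
  rcases le_or_gt n 20 with h | h
  · rw [Polynomial.revAt_le h, coeff_consistentNumerator, coeff_consistentNumerator]
    interval_cases n <;> rfl
  · rw [Polynomial.revAt_eq_self_of_lt h]

theorem isQuasipolynomial_constituent :
    IsQuasipolynomial (fun x => constituent (x % 12).toNat x) 5 12 := by
  refine ⟨fun i x => constituentCoeff (x % 12).toNat i, fun x => rfl, fun h => ?_,
    ⟨by norm_num, fun i x => by simp⟩, ?_⟩
  · have := congrFun h 0
    norm_num [constituentCoeff, Fin.last] at this
  · rintro q ⟨hq, hper⟩
    by_contra! hlt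
    -- The constant coefficient equals 1 only in the residue class 0, so no period `q` with `0 < q <
    -- 12` is possible.
    have h0 : constituentCoeff ((0 + (q : ℤ)) % 12).toNat 0 = constituentCoeff 0 0 := hper 0 0
    rw [show ((0 + (q : ℤ)) % 12).toNat = q by omega] at h0
    interval_cases q <;> norm_num [constituentCoeff] at h0

theorem mainTheorem6 :
    -- the counted sets are finite
    (∀ G : ℕ, (ScoreSheet.consistentSheets 3 G).Finite) ∧
    -- the count is a quasipolynomial of degree 5 and (minimal) period 12
    (∃ Q : ℤ → ℚ, IsQuasipolynomial Q 5 12 ∧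
      ∀ G : ℕ, (ScoreSheet.numConsistent 3 G : ℚ) = Q (G : ℤ)) ∧
    -- the Hilbert series, with denominators cleared
    (PowerSeries.mk (fun G : ℕ => (ScoreSheet.numConsistent 3 G : ℤ)) *
        ((1 - PowerSeries.X) ^ 2 * (1 - PowerSeries.X ^ 3) * (1 - PowerSeries.X ^ 6) ^ 2 *
          (1 - PowerSeries.X ^ 12)) =
      (consistentNumerator : PowerSeries ℤ)) ∧
    -- the numerator has degree 20 and is palindromic
    consistentNumerator.natDegree = 20 ∧ consistentNumerator.reverse = consistentNumerator ∧
    -- the twelve constituent polynomials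
    (∀ G : ℕ,
      (G ≡ 0 [MOD 12] → (ScoreSheet.numConsistent 3 G : ℚ) =
        1 + 49 / 45 * (G : ℚ) + 1 / 2 * (G : ℚ) ^ 2 + 299 / 2592 * (G : ℚ) ^ 3
          + 91 / 6912 * (G : ℚ) ^ 4 + 91 / 155520 * (G : ℚ) ^ 5) ∧
      (G ≡ 1 [MOD 12] → (ScoreSheet.numConsistent 3 G : ℚ) =
        34291 / 62208 + 44263 / 51840 * (G : ℚ) + 14521 / 31104 * (G : ℚ) ^ 2 + 889 / 7776 * (G : ℚ) ^ 3
          + 91 / 6912 * (G : ℚ) ^ 4 + 91 / 155520 * (G : ℚ) ^ 5) ∧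
      (G ≡ 2 [MOD 12] → (ScoreSheet.numConsistent 3 G : ℚ) =
        3245 / 3888 + 1679 / 1620 * (G : ℚ) + 947 / 1944 * (G : ℚ) ^ 2 + 889 / 7776 * (G : ℚ) ^ 3
          + 91 / 6912 * (G : ℚ) ^ 4 + 91 / 155520 * (G : ℚ) ^ 5) ∧
      (G ≡ 3 [MOD 12] → (ScoreSheet.numConsistent 3 G : ℚ) =
        145 / 256 + 5327 / 5760 * (G : ℚ) + 185 / 384 * (G : ℚ) ^ 2 + 299 / 2592 * (G : ℚ) ^ 3
          + 91 / 6912 * (G : ℚ) ^ 4 + 91 / 155520 * (G : ℚ) ^ 5) ∧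
      (G ≡ 4 [MOD 12] → (ScoreSheet.numConsistent 3 G : ℚ) =
        214 / 243 + 1649 / 1620 * (G : ℚ) + 943 / 1944 * (G : ℚ) ^ 2 + 889 / 7776 * (G : ℚ) ^ 3
          + 91 / 6912 * (G : ℚ) ^ 4 + 91 / 155520 * (G : ℚ) ^ 5) ∧
      (G ≡ 5 [MOD 12] → (ScoreSheet.numConsistent 3 G : ℚ) =
        35315 / 62208 + 45223 / 51840 * (G : ℚ) + 14585 / 31104 * (G : ℚ) ^ 2 + 889 / 7776 * (G : ℚ) ^ 3
          + 91 / 6912 * (G : ℚ) ^ 4 + 91 / 155520 * (G : ℚ) ^ 5) ∧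
      (G ≡ 6 [MOD 12] → (ScoreSheet.numConsistent 3 G : ℚ) =
        15 / 16 + 49 / 45 * (G : ℚ) + 1 / 2 * (G : ℚ) ^ 2 + 299 / 2592 * (G : ℚ) ^ 3
          + 91 / 6912 * (G : ℚ) ^ 4 + 91 / 155520 * (G : ℚ) ^ 5) ∧
      (G ≡ 7 [MOD 12] → (ScoreSheet.numConsistent 3 G : ℚ) =
        30403 / 62208 + 44263 / 51840 * (G : ℚ) + 14521 / 31104 * (G : ℚ) ^ 2 + 889 / 7776 * (G : ℚ) ^ 3
          + 91 / 6912 * (G : ℚ) ^ 4 + 91 / 155520 * (G : ℚ) ^ 5) ∧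
      (G ≡ 8 [MOD 12] → (ScoreSheet.numConsistent 3 G : ℚ) =
        218 / 243 + 1679 / 1620 * (G : ℚ) + 947 / 1944 * (G : ℚ) ^ 2 + 889 / 7776 * (G : ℚ) ^ 3
          + 91 / 6912 * (G : ℚ) ^ 4 + 91 / 155520 * (G : ℚ) ^ 5) ∧
      (G ≡ 9 [MOD 12] → (ScoreSheet.numConsistent 3 G : ℚ) =
        161 / 256 + 5327 / 5760 * (G : ℚ) + 185 / 384 * (G : ℚ) ^ 2 + 299 / 2592 * (G : ℚ) ^ 3
          + 91 / 6912 * (G : ℚ) ^ 4 + 91 / 155520 * (G : ℚ) ^ 5) ∧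
      (G ≡ 10 [MOD 12] → (ScoreSheet.numConsistent 3 G : ℚ) =
        3181 / 3888 + 1649 / 1620 * (G : ℚ) + 943 / 1944 * (G : ℚ) ^ 2 + 889 / 7776 * (G : ℚ) ^ 3
          + 91 / 6912 * (G : ℚ) ^ 4 + 91 / 155520 * (G : ℚ) ^ 5) ∧
      (G ≡ 11 [MOD 12] → (ScoreSheet.numConsistent 3 G : ℚ) =
        31427 / 62208 + 45223 / 51840 * (G : ℚ) + 14585 / 31104 * (G : ℚ) ^ 2 + 889 / 7776 * (G : ℚ) ^ 3
          + 91 / 6912 * (G : ℚ) ^ 4 + 91 / 155520 * (G : ℚ) ^ 5)) := by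
  have hN : ∀ G : ℕ, (ScoreSheet.numConsistent 3 G : ℚ) = constituent (G % 12) G := fun G => by
    exact_mod_cast eq_constituent_of_hilbertSeries _ hilbertSeries_numConsistent G
  refine ⟨fun G => (ScoreSheet.hasGenFun_isConsistent G).1,
    ⟨_, isQuasipolynomial_constituent, fun G => ?_⟩, hilbertSeries_numConsistent,
    natDegree_consistentNumerator, reverse_consistentNumerator, fun G => ?_⟩
  · rw [hN]
    norm_cast
  · obtain ⟨h0, h1, h2, h3, h4, h5, h6, h7, h8, h9, h10, h11⟩ := constituent_apply (G : ℚ)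
    rw [hN]
    refine ⟨fun h => ?_, fun h => ?_, fun h => ?_, fun h => ?_, fun h => ?_, fun h => ?_,
      fun h => ?_, fun h => ?_, fun h => ?_, fun h => ?_, fun h => ?_, fun h => ?_⟩
    all_goals
      rw [show G % 12 = _ from h]
      assumption
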